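/- Speed-robust scheduling of equal jobs (bricks) with as many bags as machines. Model. In the first stage one is given positive integers $n, m, b$ (numbers of jobs, machines, bags) and processing times $p_1,\dots,p_n\ge 0$. A first-stage algorithm outputs a mapping $B:\{1,\dots,n\}\to\{1,\dots,b\}$; the size of bag $k$ is $a_k=\sum_{j:B(j)=k}p_j$. In the second stage speeds $s_1,\dots,s_m\ge 0$, not all $0$, are revealed, and the bags are assigned to machines; a machine of speed $0$ must receive no bag. The makespan $C_{\max}$ is the maximum over machines of (total size of its bags)$/s_i$ (and $0$ for a machine of speed $0$). Let $C^*_{\max}$ be the minimum makespan over all assignments of the jobs directly to the machines under the same rules. The algorithm is $\rho$-robust on a class of first-stage inputs if for every input in the class and all speeds there is a second-stage assignment with $C_{\max}\le\rho\, C^*_{\max}$. Algorithms. * *Pebbles* (parameter $\rho$; processing times scaled so that $\sum_j p_j=m$): process the jobs in order, keeping a current bag $k$, initially $1$, and current bag sizes $d_1,\dots,d_b$, initially $0$. For job $j$: while $k\le b$ and $d_k+p_j>\rho-\frac1m\sum_{\ell<k}d_\ell$, increase $k$ by $1$; if $k>b$, stop; otherwise put job $j$ into bag $k$ and increase $d_k$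 by $p_j$. * *Bricks* (parameter $\rho$; processing times scaled to $1$): start with $c=n$ coins; for $k=1,\dots,b$ let $z=\lceil c/m\rceil$, give bag $k$ capacity $\lfloor z\rho\rfloor$, and replace $c$ by $c-z$. The jobs are then filled into the bags in order, each bag up to its capacity, while jobs last. The algorithm succeeds if the total capacity is at least $n$, i.e. all jobs are placed. * *IntegralAssignment* (parameter $\rho$; bag sizes $a_1,\dots,a_b$, speeds $s_1,\dots,s_m$): start with $c_i=s_i$; for $k=1,\dots,b$ assign bag $k$ to a machine $i$ of non-zero speed with the largest $c_i$ among these (ties broken arbitrarily), and replace $c_i$ by $c_i-\lceil a_k/\rho\rceil$. **Theorem.** There is a first-stage algorithm that is $1.6$-robust on all inputs with $b=m$ and $p_1=\dots=p_n$. Write $\lambda=n/m$. Such an algorithm is obtained by running Pebbles with $\rho=1.6$ (on the processing times scaled to total $m$) if $\lambda\ge 60$, and Bricks with $\rho=1.6$ if $\lambda<60$; in these cases both place all jobs. Moreover, for every $n,m\ge 1$ with $\lambda\le 60$ and $b=m$, Bricks with $\rho=1.6$ succeeds, and IntegralAssignment with $\rho=1.6$ solves the second stage: for every common processing time $p\ge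 0$, all speeds $s_1,\dots,s_m$ as above and every optimal schedule of the jobs, let $s'_i$ be the number of jobs that this schedule places on machine $i$. Then every run of IntegralAssignment on the bag sizes produced by Bricks (in numbers of jobs) and the speeds $s'_1,\dots,s'_m$ (such a run exists) gives an assignment of the bags which, for the original speeds $s_i$, puts no bag on a machine of speed $0$ and has makespan $C_{\max}\le 1.6\, C^*_{\max}$. -/

import Mathlib

/-! # Speed-robust scheduling: the two-stage model and the algorithms -/

noncomputable section

namespace SpeedRobust

/-- The total weight that the assignment `f` puts on the target `i`. It is used both for the size of
a bag (jobs assigned to bags) and for the load of a machine (bags or jobs assigned to machines). -/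
def load {k l : ℕ} (w : Fin k → ℝ) (f : Fin k → Fin l) (i : Fin l) : ℝ :=
  ∑ j with f j = i, w j

/-- Machines of speed `0` accept nothing. -/
def IsFeasible {k m : ℕ} (s : Fin m → ℝ) (f : Fin k → Fin m) : Prop :=
  ∀ j, s (f j) ≠ 0

/-- The makespan `max_i (load of machine i) / s_i`. For a feasible assignment, a machine of speed `0`
has load `0`, and its completion time `0 / 0 = 0` agrees with the usual convention. -/
def makespan {k m : ℕ} (w : Fin k → ℝ) (s : Fin m → ℝ) (f : Fin k → Fin m) : ℝ :=
  ⨆ i, load w f i / s i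

/-- The optimal makespan of the adversary, who knows the speeds `s` and assigns the jobs directly. -/
def optMakespan {n m : ℕ} (p : Fin n → ℝ) (s : Fin m → ℝ) : ℝ :=
  sInf {C | ∃ τ : Fin n → Fin m, IsFeasible s τ ∧ makespan p s τ = C}

/-- `τ` is an optimal schedule of the jobs on machines of speeds `s`. -/
def IsOptimal {n m : ℕ} (p : Fin n → ℝ) (s : Fin m → ℝ) (τ : Fin n → Fin m) : Prop :=
  IsFeasible s τ ∧ makespan p s τ = optMakespan p s

/-- Admissible speeds: non-negative and not all equal to `0`. -/
def IsSpeed {m : ℕ} (s : Fin m → ℝ) : Prop :=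
  (∀ i, 0 ≤ s i) ∧ ∃ i, s i ≠ 0

/-- A first-stage algorithm receives the numbers of jobs, machines and bags together with the
processing times, and maps the jobs to the bags. -/
abbrev FirstStageAlgorithm : Type :=
  ∀ (n m b : ℕ) [NeZero b], (Fin n → ℝ) → Fin n → Fin b

/-- A first-stage algorithm is `ρ`-robust on a class of first-stage inputs. -/
def IsRobustOn (A : FirstStageAlgorithm) (inputs : ∀ n : ℕ, ℕ → ℕ → (Fin n → ℝ) → Prop)
    (ρ : ℝ) : Prop :=
  ∀ (n m b : ℕ) [NeZero b] (p : Fin n → ℝ), 0 < n → 0 < m → (∀ j, 0 ≤ p j) →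
    inputs n m b p →
    ∀ s : Fin m → ℝ, IsSpeed s →
      ∃ σ : Fin b → Fin m, IsFeasible s σ ∧
        makespan (load p (A n m b p)) s σ ≤ ρ * optMakespan p s

/-- Bricks: all jobs have the same processing time. -/
def IsBricks {n : ℕ} (p : Fin n → ℝ) : Prop :=
  ∀ j j', p j = p j'

/-! ## Algorithm Pebbles

Bags are numbered from `0`. The state consists of the index of the current bag and of the current
bag sizes. -/

/-- The inner loop: starting at bag `k`, move on to the next bag as long as `k < b` and adding a job
of size `x` to bag `k` would violate `d k + x ≤ ρ - (1 / m) * ∑ ℓ < k, d ℓ`. -/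
def pebblesSkip (ρ : ℝ) (m b : ℕ) (d : ℕ → ℝ) (x : ℝ) (k : ℕ) : ℕ :=
  if k < b ∧ ρ - 1 / (m : ℝ) * ∑ ℓ ∈ Finset.range k, d ℓ < d k + x then
    pebblesSkip ρ m b d x (k + 1)
  else k
termination_by b - k

/-- One pass of the outer loop, for a job of size `x`. When there is no bag left (`k ≥ b`) nothing
changes any more. -/
def pebblesStep (ρ : ℝ) (m b : ℕ) (x : ℝ) (S : ℕ × (ℕ → ℝ)) : ℕ × (ℕ → ℝ) :=
  let k := pebblesSkip ρ m b S.2 x S.1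
  if k < b then (k, Function.update S.2 k (S.2 k + x)) else (k, S.2)

/-- The state after the first `t` jobs. -/
def pebblesState (ρ : ℝ) (m b : ℕ) {n : ℕ} (p : Fin n → ℝ) : ℕ → ℕ × (ℕ → ℝ)
  | 0 => (0, fun _ => 0)
  | t + 1 =>
      if h : t < n then pebblesStep ρ m b (p ⟨t, h⟩) (pebblesState ρ m b p t)
      else pebblesState ρ m b p t

/-- The output of Pebbles: the bag of job `j`, or `none` if the algorithm ran out of bags. -/
def pebbles (ρ : ℝ) (m b : ℕ) {n : ℕ} (p : Fin n → ℝ) (j : Fin n) : Option (Fin b) :=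
  if h : (pebblesState ρ m b p (j + 1)).1 < b then
    some ⟨(pebblesState ρ m b p (j + 1)).1, h⟩
  else none

/-- The processing times, scaled so that the average load is `1` (the total is `m`). -/
def normalize (m : ℕ) {n : ℕ} (p : Fin n → ℝ) : Fin n → ℝ :=
  fun j => p j * m / ∑ i, p i

/-! ## Algorithm Bricks -/

/-- The number of coins left after `k` bags have been paid for; a bag costs `⌈c / m⌉` coins when `c`
coins are left. -/
def bricksCoins (n m : ℕ) : ℕ → ℕ
  | 0 => n
  | k + 1 => bricksCoins n m k - bricksCoins n m k ⌈/⌉ m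

/-- The size `⌊z * ρ⌋` of bag `k` (numbered from `0`), where `z` is its cost. -/
def bricksSize (ρ : ℝ) (n m k : ℕ) : ℕ :=
  ⌊((bricksCoins n m k ⌈/⌉ m : ℕ) : ℝ) * ρ⌋₊

/-- The output of Bricks: the jobs are put into the bags one after the other, bag `k` taking
`bricksSize ρ n m k` jobs while jobs last. Thus surplus capacity is removed from the last bags. The
value is `none` if the total size of the `b` bags is too small to accommodate job `j`. -/
def bricks (ρ : ℝ) (n m b : ℕ) (j : Fin n) : Option (Fin b) :=
  if h : ∃ k, k < b ∧ (j : ℕ) < ∑ i ∈ Finset.range (k + 1), bricksSize ρ n m i then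
    some ⟨Nat.find h, (Nat.find_spec h).1⟩
  else none

/-! ## Second-stage algorithm IntegralAssignment -/

/-- The coins of machine `i` just before bag `k` is assigned: initially `s i`, and every bag `k'`
put on the machine costs `⌈a k' / ρ⌉`. -/
def integralCoins (ρ : ℝ) {b m : ℕ} (a : Fin b → ℝ) (s : Fin m → ℝ) (σ : Fin b → Fin m)
    (k : Fin b) (i : Fin m) : ℝ :=
  s i - ∑ k' with k' < k ∧ σ k' = i, (⌈a k' / ρ⌉ : ℝ)

/-- `σ` is a possible output of IntegralAssignment on bag sizes `a` and speeds `s`: the bags are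
assigned in order, each to a machine with the largest number of coins among those which accept bags,
i.e. which have non-zero speed. Ties are broken arbitrarily. -/
def IsIntegralAssignment (ρ : ℝ) {b m : ℕ} (a : Fin b → ℝ) (s : Fin m → ℝ)
    (σ : Fin b → Fin m) : Prop :=
  ∀ k, s (σ k) ≠ 0 ∧
    ∀ i, s i ≠ 0 → integralCoins ρ a s σ k i ≤ integralCoins ρ a s σ k (σ k)

end SpeedRobust

end

namespace SpeedRobust

/-! ## Bricks packs all jobs -/

/-! Both second stages rest on averaging: the largest remaining budget is at least the remaining
total over `m`, so a greedy assignment never overdraws a budget if every bag is at most that average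
(`IsGreedy.sum_le`, `load_le_of_le_remaining`). For Bricks the budgets are whole coins, so the
average may be rounded up, which is exactly the price `⌈c / m⌉` of a bag.

It remains to place all jobs. In Pebbles, `m` full bags obey a recurrence forcing their total above
`m * (8/5 - x) * (1 - 1/e)`, where `x` is the job size. This exceeds `m` for `x ≤ 1/60`, since `e /
(e - 1) < 8/5 - 1/60` (`lt_sum_of_full`).

For Bricks with `n ≤ 60 * m`, let `w` be the price of the last bag, the cheapest one. Every bag
holds at least `brickGain w` jobs, and its surplus is spread over the coins that pay for it. Coin
`i` has level `i / m + 1`; a bag of price `z` uses coins of level at most `z`, so a rate monotone in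
the level bounds the surplus from below. Summing over all bags reduces the claim to an inequality
that is linear between consecutive multiples of `m`, hence to finitely many integer checks
(`gainCheck_all`). -/

/-- The size of a bag of cost `z`, for the parameter `8 / 5`. -/
def brickGain (z : ℕ) : ℕ := 8 * z / 5

/-- The gain of a bag of cost `u` over a bag of cost `w`, per coin and in multiples of `1 / 30`. -/
def gainRate (w u : ℕ) : ℕ := 30 * (brickGain u - brickGain w) / u

/-- A lower bound for `gainRate w u` that is monotone in `u`. -/
def minGainRate (w v : ℕ) : ℕ :=
  min (gainRate w v) (min (gainRate w (v + 1)) (min (gainRate w (v + 2))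
    (min (gainRate w (v + 3)) (gainRate w (v + 4)))))

/-- Five more coins buy exactly eight more jobs, a rate of 48 thirtieths per coin. The rate at `u`
is at most 48, so averaging the two cannot lower it. -/
lemma gainRate_le_add_five (w u : ℕ) : gainRate w u ≤ gainRate w (u + 5) := by
  rcases Nat.eq_zero_or_pos u with rfl | hu
  · simp [gainRate]
  unfold gainRate
  rw [Nat.le_div_iff_mul_le (by omega)]
  have h5 : brickGain (u + 5) = brickGain u + 8 := by unfold brickGain; omega
  rcases Nat.lt_or_ge (brickGain u) (brickGain w) with h | h
  · have : brickGain u - brickGain w = 0 := by omega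
    simp [this]
  · set a := 30 * (brickGain u - brickGain w) with ha
    have h1 : a / u * u ≤ a := Nat.div_mul_le_self a u
    have h2 : 5 * a ≤ 240 * u := by
      have : 5 * brickGain u ≤ 8 * u := by unfold brickGain; omega
      omega
    have h3 : a / u * 5 ≤ 240 := by
      by_contra hc
      push Not at hc
      have : 241 * u ≤ a / u * 5 * u := Nat.mul_le_mul_right u hc
      nlinarith
    have h4 : 30 * (brickGain (u + 5) - brickGain w) = a + 240 := by omega
    rw [h4, mul_add]
    omega

/-- Sliding the window of five drops `gainRate w v` and admits `gainRate w (v + 5)`, which is no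
smaller. `gainRate` itself is not monotone, because of the floors in `brickGain`. -/
lemma minGainRate_monotone (w : ℕ) : Monotone (minGainRate w) := by
  refine monotone_nat_of_le_succ fun v => ?_
  have := gainRate_le_add_five w v
  simp only [minGainRate]
  have e1 : v + 1 + 1 = v + 2 := rfl
  have e2 : v + 1 + 2 = v + 3 := rfl
  have e3 : v + 1 + 3 = v + 4 := rfl
  have e4 : v + 1 + 4 = v + 5 := rfl
  rw [e1, e2, e3, e4]
  omega

lemma brickGain_monotone : Monotone brickGain := fun a b h => by
  unfold brickGain; omega

lemma minGainRate_eq_zero {w v : ℕ} (h : v ≤ w) : minGainRate w v = 0 := by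
  have h1 : brickGain v - brickGain w = 0 := Nat.sub_eq_zero_of_le (brickGain_monotone h)
  have h2 : gainRate w v = 0 := by simp [gainRate, h1]
  simp [minGainRate, h2]

lemma mul_minGainRate_le {w z : ℕ} (h : w ≤ z) :
    z * minGainRate w z + 30 * brickGain w ≤ 30 * brickGain z := by
  have h1 : z * minGainRate w z ≤ 30 * (brickGain z - brickGain w) :=
    (Nat.mul_le_mul_left z (min_le_left _ _)).trans (Nat.mul_div_le _ _)
  have h2 := brickGain_monotone h
  omega

/-- Starting from `S` at `x`, the partial sums of `minGainRate w` stay above `30 * x` for `k` steps. -/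
def gainCheck (w : ℕ) : ℕ → ℕ → ℕ → Bool
  | 0, _, _ => true
  | k + 1, x, S =>
      Nat.ble (30 * (x + 1)) (S + minGainRate w (x + 1)) &&
        gainCheck w k (x + 1) (S + minGainRate w (x + 1))

lemma gainCheck_sound (w c : ℕ) (k x S : ℕ) (h : gainCheck w k x S = true)
    (hS : S = c + ∑ v ∈ Finset.range x, minGainRate w (v + 1)) (hx : 30 * x ≤ S) :
    ∀ y, x ≤ y → y ≤ x + k →
      30 * y ≤ c + ∑ v ∈ Finset.range y, minGainRate w (v + 1) := by
  induction k generalizing x S with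
  | zero =>
    intro y h1 h2
    obtain rfl : y = x := by omega
    omega
  | succ k ih =>
    intro y h1 h2
    simp only [gainCheck, Bool.and_eq_true, Nat.ble_eq] at h
    rcases Nat.eq_or_lt_of_le h1 with rfl | h3
    · omega
    · refine ih (x + 1) _ h.2 ?_ h.1 y h3 (by omega)
      rw [Finset.sum_range_succ, hS, add_assoc]

lemma gainCheck_all : ∀ w < 61, gainCheck w 60 0 (30 * brickGain w) = true := by
  decide +kernel

/-- The packing inequality at `n = x * m`, divided by `m`; other values of `n` follow by
interpolation. -/
lemma le_sum_minGainRate {w x : ℕ} (hw : w ≤ 60) (hx : x ≤ 60) :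
    30 * x ≤ 30 * brickGain w + ∑ v ∈ Finset.range x, minGainRate w (v + 1) :=
  gainCheck_sound w _ 60 0 _ (gainCheck_all w (by omega)) (by simp) (by simp) x (by omega)
    (by omega)

lemma sum_range_div (f : ℕ → ℕ) {m : ℕ} (hm : 0 < m) (a r : ℕ) (hr : r ≤ m) :
    ∑ i ∈ Finset.range (a * m + r), f (i / m) = m * ∑ j ∈ Finset.range a, f j + r * f a := by
  have block : ∀ a r : ℕ, r ≤ m →
      ∑ i ∈ Finset.range r, f ((a * m + i) / m) = r * f a := by
    intro a r hr
    rw [Finset.sum_congr rfl (g := fun _ => f a)]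
    · simp
    · intro i hi
      rw [Finset.mem_range] at hi
      rw [mul_comm, Nat.mul_add_div hm, Nat.div_eq_of_lt (by omega), add_zero]
  rw [Finset.sum_range_add, block a r hr]
  congr 1
  induction a with
  | zero => simp
  | succ a ih =>
    rw [Nat.succ_mul, Finset.sum_range_add, ih, block a m le_rfl, Finset.sum_range_succ, mul_add]

/-! ### Coins and bag sizes along a run of Bricks -/

lemma ceilDiv_le_self {m : ℕ} (hm : 0 < m) (c : ℕ) : c ⌈/⌉ m ≤ c := by
  rw [ceilDiv_le_iff_le_smul hm, smul_eq_mul]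
  nlinarith

lemma bricksCoins_add_cost {n m : ℕ} (hm : 0 < m) (k : ℕ) :
    bricksCoins n m (k + 1) + bricksCoins n m k ⌈/⌉ m = bricksCoins n m k := by
  have := ceilDiv_le_self hm (bricksCoins n m k)
  rw [bricksCoins]
  omega

lemma bricksCoins_add_sum {n m : ℕ} (hm : 0 < m) (k : ℕ) :
    bricksCoins n m k + ∑ i ∈ Finset.range k, bricksCoins n m i ⌈/⌉ m = n := by
  induction k with
  | zero => simp [bricksCoins]
  | succ k ih =>
    have := bricksCoins_add_cost (n := n) hm k
    rw [Finset.sum_range_succ]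
    omega

lemma bricksCoins_antitone (n m : ℕ) : Antitone (bricksCoins n m) :=
  antitone_nat_of_succ_le fun _ => Nat.sub_le _ _

lemma bricksSize_eq (n m k : ℕ) :
    bricksSize (8 / 5) n m k = brickGain (bricksCoins n m k ⌈/⌉ m) := by
  unfold bricksSize brickGain
  rw [← Nat.floor_div_eq_div (K := ℝ)]
  congr 1
  push_cast
  ring

/-- The potential of `c` remaining coins drops, while a bag is paid for, by at most the gain of this
bag over a bag of cost `w`. -/
lemma sum_minGainRate_step {w m c : ℕ} (hm : 0 < m) (hw : w ≤ c ⌈/⌉ m) :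
    ∑ i ∈ Finset.range c, minGainRate w (i / m + 1) + 30 * brickGain w ≤
      ∑ i ∈ Finset.range (c - c ⌈/⌉ m), minGainRate w (i / m + 1) +
        30 * brickGain (c ⌈/⌉ m) := by
  set z := c ⌈/⌉ m with hz
  have hzc : z ≤ c := ceilDiv_le_self hm c
  have hcz : c ≤ m * z := by
    have := (ceilDiv_le_iff_le_smul (a := m) (b := c) (c := z) hm).1 le_rfl
    simpa using this
  have h1 : ∑ i ∈ Finset.range c, minGainRate w (i / m + 1) =
      ∑ i ∈ Finset.range (c - z), minGainRate w (i / m + 1) +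
        ∑ i ∈ Finset.range z, minGainRate w ((c - z + i) / m + 1) := by
    rw [← Finset.sum_range_add]
    congr 2
    omega
  -- The coins spent have indices below `c ≤ m * z`, hence level at most `z`.
  have h2 : ∑ i ∈ Finset.range z, minGainRate w ((c - z + i) / m + 1) ≤
      z * minGainRate w z := by
    have := Finset.sum_le_card_nsmul (Finset.range z)
      (fun i => minGainRate w ((c - z + i) / m + 1)) (minGainRate w z) (by
        intro i hi
        rw [Finset.mem_range] at hi
        refine minGainRate_monotone w ?_
        rw [Nat.succ_le_iff, Nat.div_lt_iff_lt_mul hm, mul_comm]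
        omega)
    simpa using this
  have h3 := mul_minGainRate_le hw
  omega

lemma le_sum_bricksSize {n m : ℕ} (hm : 0 < m) (hn : n ≤ 60 * m) :
    n ≤ ∑ k ∈ Finset.range m, bricksSize (8 / 5) n m k := by
  obtain ⟨m', rfl⟩ : ∃ m', m = m' + 1 := ⟨m - 1, by omega⟩
  set m := m' + 1 with hmdef
  set w := bricksCoins n m m' ⌈/⌉ m with hw
  let Ψ : ℕ → ℕ := fun c => ∑ i ∈ Finset.range c, minGainRate w (i / m + 1)
  have hcm : ∀ {a b : ℕ}, a ≤ b → a ⌈/⌉ m ≤ b ⌈/⌉ m := fun {a b} h => by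
    rw [Nat.ceilDiv_eq_add_pred_div, Nat.ceilDiv_eq_add_pred_div]
    exact Nat.div_le_div_right (by omega)
  have key : ∀ k ≤ m, Ψ n + k * (30 * brickGain w) ≤
      Ψ (bricksCoins n m k) + 30 * ∑ i ∈ Finset.range k, bricksSize (8 / 5) n m i := by
    intro k hk
    induction k with
    | zero => simp [bricksCoins]
    | succ k ih =>
      have h1 := ih (by omega)
      have h2 : w ≤ bricksCoins n m k ⌈/⌉ m := hcm (bricksCoins_antitone n m (by omega))
      have h3 := sum_minGainRate_step hm h2
      rw [Finset.sum_range_succ, bricksSize_eq, add_mul, one_mul, mul_add]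
      simp only [Ψ, bricksCoins] at h1 h3 ⊢
      omega
  -- Coins left at the end have level at most `w`, where the rate vanishes.
  have hΨ : Ψ (bricksCoins n m m) = 0 := by
    refine Finset.sum_eq_zero fun i hi => minGainRate_eq_zero ?_
    rw [Finset.mem_range] at hi
    have h1 : bricksCoins n m m ≤ bricksCoins n m m' := bricksCoins_antitone n m (by omega)
    have h2 := (ceilDiv_le_iff_le_smul (a := m) (b := bricksCoins n m m') (c := w) hm).1 le_rfl
    rw [smul_eq_mul] at h2
    rw [Nat.succ_le_iff, Nat.div_lt_iff_lt_mul hm, mul_comm]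
    omega
  have hw60 : w ≤ 60 := by
    rw [hw, ceilDiv_le_iff_le_smul hm, smul_eq_mul]
    have : bricksCoins n m m' ≤ n := bricksCoins_antitone n m (Nat.zero_le m')
    omega
  have main : 30 * n ≤ Ψ n + m * (30 * brickGain w) := by
    rcases Nat.eq_zero_or_pos n with h0 | hpos
    · simp [h0]
    obtain ⟨a, r, hr, har⟩ : ∃ a r, r ≤ m ∧ n = a * m + r ∧ a < 60 := by
      -- Taking the remainder in `1, …, m` keeps `a + 1 ≤ 60` even when `n = 60 * m`.
      refine ⟨(n - 1) / m, (n - 1) % m + 1, Nat.mod_lt _ hm, ?_, ?_⟩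
      · have := Nat.div_add_mod' (n - 1) m
        omega
      · rw [Nat.div_lt_iff_lt_mul hm]
        omega
    have hs := sum_range_div (fun j => minGainRate w (j + 1)) hm a r hr
    rw [← har.1] at hs
    have e1 := le_sum_minGainRate (w := w) (x := a) hw60 (by omega)
    have e2 := le_sum_minGainRate (w := w) (x := a + 1) hw60 (by omega)
    rw [Finset.sum_range_succ] at e2
    -- With `m = r + r'`, `n = r' * a + r * (a + 1)`: weight the checks at `a` and `a + 1` by `r'`
    -- and `r`.
    obtain ⟨r', hr'⟩ := Nat.exists_eq_add_of_le hr
    have f1 := Nat.mul_le_mul_left r' e1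
    have f2 := Nat.mul_le_mul_left r e2
    simp only [Ψ]
    rw [hs]
    generalize (∑ v ∈ Finset.range a, minGainRate w (v + 1)) = T at *
    generalize minGainRate w (a + 1) = h at *
    rw [har.1, hr']
    nlinarith
  have := key m le_rfl
  rw [hΨ] at this
  omega

/-- The bag into which Bricks puts job `j`, if the bags are large enough. -/
lemma exists_bricks_eq_some {n m : ℕ} (hm : 0 < m) (hn : n ≤ 60 * m) :
    ∃ B : Fin n → Fin m, (∀ j, bricks (8 / 5) n m m j = some (B j)) ∧
      ∀ k, (Finset.univ.filter fun j => B j = k).card ≤ bricksSize (8 / 5) n m k := by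
  have hex : ∀ j : Fin n, ∃ k, k < m ∧
      (j : ℕ) < ∑ i ∈ Finset.range (k + 1), bricksSize (8 / 5) n m i := by
    intro j
    refine ⟨m - 1, by omega, ?_⟩
    rw [Nat.sub_add_cancel hm]
    exact j.2.trans_le (le_sum_bricksSize hm hn)
  refine ⟨fun j => ⟨Nat.find (hex j), (Nat.find_spec (hex j)).1⟩, fun j => ?_, fun k => ?_⟩
  · rw [bricks, dif_pos (hex j)]
  · set S := ∑ i ∈ Finset.range (k : ℕ), bricksSize (8 / 5) n m i with hS
    have hsub : ((Finset.univ.filter fun j : Fin n =>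
        (⟨Nat.find (hex j), (Nat.find_spec (hex j)).1⟩ : Fin m) = k).map Fin.valEmbedding) ⊆
        Finset.Ico S (S + bricksSize (8 / 5) n m k) := by
      intro x hx
      simp only [Finset.mem_map, Finset.mem_filter, Finset.mem_univ, true_and,
        Fin.valEmbedding_apply] at hx
      obtain ⟨j, hj, rfl⟩ := hx
      have hj' : Nat.find (hex j) = k := congrArg Fin.val hj
      have h1 := (Nat.find_spec (hex j)).2
      rw [hj', Finset.sum_range_succ] at h1
      refine Finset.mem_Ico.2 ⟨?_, h1⟩
      rcases Nat.eq_zero_or_pos (k : ℕ) with h0 | hpos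
      · simp [hS, h0]
      · by_contra hlt
        -- Minimality rejects bag `k - 1`, so the earlier capacities do not reach job `j`.
        have h2 := Nat.find_min (hex j) (m := (k : ℕ) - 1) (by omega)
        refine h2 ⟨by omega, ?_⟩
        rw [Nat.sub_add_cancel hpos]
        omega
    have := Finset.card_le_card hsub
    simpa using this

/-! ## Makespans -/

lemma sum_load {k l : ℕ} (w : Fin k → ℝ) (f : Fin k → Fin l) : ∑ i, load w f i = ∑ j, w j :=
  Finset.sum_fiberwise _ _ _

lemma load_nonneg {k l : ℕ} {w : Fin k → ℝ} (hw : ∀ j, 0 ≤ w j) (f : Fin k → Fin l) (i : Fin l) :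
    0 ≤ load w f i :=
  Finset.sum_nonneg fun j _ => hw j

lemma load_const {k l : ℕ} (c : ℝ) (f : Fin k → Fin l) (i : Fin l) :
    load (fun _ => c) f i = c * load (fun _ => 1) f i := by
  simp [load, mul_comm]

lemma load_eq_zero {k m : ℕ} {w : Fin k → ℝ} {s : Fin m → ℝ} {f : Fin k → Fin m}
    (hf : IsFeasible s f) {i : Fin m} (hi : s i = 0) : load w f i = 0 := by
  refine Finset.sum_eq_zero fun j hj => absurd hi ?_
  rw [← (Finset.mem_filter.1 hj).2]
  exact hf j

lemma makespan_nonneg {k m : ℕ} {w : Fin k → ℝ} {s : Fin m → ℝ} (hw : ∀ j, 0 ≤ w j)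
    (hs : ∀ i, 0 ≤ s i) (f : Fin k → Fin m) : 0 ≤ makespan w s f :=
  Real.iSup_nonneg fun i => div_nonneg (load_nonneg hw f i) (hs i)

lemma makespan_le {k m : ℕ} {w : Fin k → ℝ} {s : Fin m → ℝ} {f : Fin k → Fin m} {C : ℝ}
    (hC : 0 ≤ C) (hs : ∀ i, 0 ≤ s i) (h : ∀ i, load w f i ≤ C * s i) : makespan w s f ≤ C :=
  Real.iSup_le (fun i => div_le_of_le_mul₀ (hs i) hC (h i)) hC

lemma load_le_makespan_mul {k m : ℕ} {w : Fin k → ℝ} {s : Fin m → ℝ} {f : Fin k → Fin m}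
    (hs : ∀ i, 0 ≤ s i) (hf : IsFeasible s f) (i : Fin m) :
    load w f i ≤ makespan w s f * s i := by
  rcases (hs i).eq_or_lt with h0 | hpos
  · rw [load_eq_zero hf h0.symm, ← h0, mul_zero]
  · rw [← div_le_iff₀ hpos]
    exact le_ciSup (f := fun i => load w f i / s i) (Set.finite_range _).bddAbove i

lemma exists_isOptimal {n m : ℕ} (p : Fin n → ℝ) {s : Fin m → ℝ} (hs : IsSpeed s) :
    ∃ τ, IsOptimal p s τ := by
  obtain ⟨i, hi⟩ := hs.2
  have hfin : {C | ∃ τ : Fin n → Fin m, IsFeasible s τ ∧ makespan p s τ = C}.Finite :=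
    (Set.toFinite {τ : Fin n → Fin m | IsFeasible s τ}).image (makespan p s)
  have hne : {C | ∃ τ : Fin n → Fin m, IsFeasible s τ ∧ makespan p s τ = C}.Nonempty :=
    ⟨_, fun _ => i, fun _ => hi, rfl⟩
  exact hne.csInf_mem hfin

/-! ## Greedy assignment of bags -/

/-- What is left of the budget `c i` just before bag `k` is assigned, if bag `k'` costs `t k'`. -/
def remaining {b m : ℕ} (t : Fin b → ℝ) (c : Fin m → ℝ) (σ : Fin b → Fin m) (k : Fin b)
    (i : Fin m) : ℝ :=
  c i - ∑ k' with k' < k ∧ σ k' = i, t k'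

/-- Every bag goes to a machine with the largest remaining budget among those satisfying `P`. -/
def IsGreedy {b m : ℕ} (P : Fin m → Prop) (t : Fin b → ℝ) (c : Fin m → ℝ)
    (σ : Fin b → Fin m) : Prop :=
  ∀ k, P (σ k) ∧ ∀ i, P i → remaining t c σ k i ≤ remaining t c σ k (σ k)

lemma remaining_congr {b m : ℕ} (t : Fin b → ℝ) (c : Fin m → ℝ) {σ σ' : Fin b → Fin m} {k : Fin b}
    (h : ∀ k' < k, σ k' = σ' k') (i : Fin m) : remaining t c σ k i = remaining t c σ' k i := by
  unfold remaining
  congr 2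
  ext k'
  simp only [Finset.mem_filter, Finset.mem_univ, true_and]
  constructor
  · rintro ⟨h1, h2⟩
    exact ⟨h1, h k' h1 ▸ h2⟩
  · rintro ⟨h1, h2⟩
    exact ⟨h1, (h k' h1).trans h2⟩

/-- Choices are made bag by bag; the remaining budgets before a bag depend only on earlier choices,
so fixing a later bag disturbs nothing. -/
lemma exists_isGreedy {b m : ℕ} {P : Fin m → Prop} (hP : ∃ i, P i) (t : Fin b → ℝ)
    (c : Fin m → ℝ) : ∃ σ, IsGreedy P t c σ := by
  classical
  obtain ⟨i₀, hi₀⟩ := hP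
  have step : ∀ N : ℕ, ∃ σ : Fin b → Fin m, ∀ k : Fin b, (k : ℕ) < N →
      P (σ k) ∧ ∀ i, P i → remaining t c σ k i ≤ remaining t c σ k (σ k) := by
    intro N
    induction N with
    | zero => exact ⟨fun _ => i₀, fun k hk => absurd hk (Nat.not_lt_zero _)⟩
    | succ N ih =>
      obtain ⟨σ, hσ⟩ := ih
      by_cases hN : N < b
      · obtain ⟨i, hi, hmax⟩ := Finset.exists_max_image (Finset.univ.filter P)
          (remaining t c σ ⟨N, hN⟩) ⟨i₀, by simpa using hi₀⟩
        have hagree : ∀ k : Fin b, (k : ℕ) < N → Function.update σ ⟨N, hN⟩ i k = σ k := by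
          intro k hk
          rw [Function.update_of_ne]
          rintro rfl
          exact lt_irrefl _ hk
        refine ⟨Function.update σ ⟨N, hN⟩ i, fun k hk => ?_⟩
        have hrem : ∀ i', remaining t c (Function.update σ ⟨N, hN⟩ i) k i' =
            remaining t c σ k i' := fun i' =>
          remaining_congr t c (fun k' hk' => hagree k' (by
            have := Fin.lt_def.1 hk'
            omega)) i'
        simp only [hrem]
        rcases Nat.lt_succ_iff_lt_or_eq.1 hk with h | h
        · rw [hagree k h]
          exact hσ k h
        · obtain rfl : k = ⟨N, hN⟩ := Fin.ext h
          rw [Function.update_self]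
          exact ⟨(Finset.mem_filter.1 hi).2, fun i' hi' => hmax i' (by simpa using hi')⟩
      · exact ⟨σ, fun k _ => hσ k (by have := k.2; omega)⟩
  obtain ⟨σ, hσ⟩ := step b
  exact ⟨σ, fun k => hσ k k.2⟩

lemma sum_remaining {b m : ℕ} (t : Fin b → ℝ) (c : Fin m → ℝ) (σ : Fin b → Fin m) (k : Fin b) :
    ∑ i, remaining t c σ k i = ∑ i, c i - ∑ k' with k' < k, t k' := by
  unfold remaining
  rw [Finset.sum_sub_distrib]
  congr 1
  rw [← Finset.sum_fiberwise _ σ]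
  refine Finset.sum_congr rfl fun i _ => ?_
  rw [Finset.filter_filter]

/-- As long as the total budget is not exhausted, a greedy choice has at least the average. -/
lemma IsGreedy.sum_le {b m : ℕ} {P : Fin m → Prop} {t : Fin b → ℝ} {c : Fin m → ℝ}
    {σ : Fin b → Fin m} (hσ : IsGreedy P t c σ) (hc : ∀ i, ¬ P i → c i = 0) (k : Fin b)
    (h0 : 0 ≤ ∑ i, c i - ∑ k' with k' < k, t k') :
    ∑ i, c i - ∑ k' with k' < k, t k' ≤ m * remaining t c σ k (σ k) := by
  have hz : ∀ i, ¬ P i → remaining t c σ k i = 0 := by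
    intro i hi
    have : ∑ k' with k' < k ∧ σ k' = i, t k' = 0 := by
      refine Finset.sum_eq_zero fun k' hk' => absurd ?_ hi
      rw [← (Finset.mem_filter.1 hk').2.2]
      exact (hσ k').1
    rw [remaining, this, hc i hi, sub_zero]
  rw [← sum_remaining t c σ k] at h0 ⊢
  -- Excluded machines contribute zero. A negative maximum over the others would make the total
  -- negative.
  have hM : 0 ≤ remaining t c σ k (σ k) := by
    by_contra hneg
    push Not at hneg
    refine absurd h0 (not_le.2 ?_)
    refine Finset.sum_neg' (fun i _ => ?_) ⟨σ k, Finset.mem_univ _, hneg⟩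
    by_cases hi : P i
    · exact ((hσ k).2 i hi).trans hneg.le
    · exact (hz i hi).le
  have := Finset.sum_le_card_nsmul Finset.univ (remaining t c σ k) (remaining t c σ k (σ k)) (by
    intro i _
    by_cases hi : P i
    · exact (hσ k).2 i hi
    · rw [hz i hi]
      exact hM)
  simpa using this

/-- If every bag fits into the remaining budget of its machine, then no budget is exceeded. -/
lemma load_le_of_le_remaining {b m : ℕ} {t : Fin b → ℝ} {c : Fin m → ℝ} {σ : Fin b → Fin m}
    (hc : ∀ i, 0 ≤ c i) (h : ∀ k, t k ≤ remaining t c σ k (σ k)) (i : Fin m) :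
    load t σ i ≤ c i := by
  unfold load
  rcases (Finset.univ.filter fun k => σ k = i).eq_empty_or_nonempty with he | hne
  · rw [he, Finset.sum_empty]
    exact hc i
  -- That the last bag on the machine fits already bounds the whole load.
  · set k := (Finset.univ.filter fun k => σ k = i).max' hne with hk
    have hmem := Finset.max'_mem _ hne
    rw [← hk, Finset.mem_filter] at hmem
    have hsplit : (Finset.univ.filter fun k' => σ k' = i) =
        insert k (Finset.univ.filter fun k' => k' < k ∧ σ k' = i) := by
      ext k'
      simp only [Finset.mem_insert, Finset.mem_filter, Finset.mem_univ, true_and]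
      constructor
      · intro h'
        rcases (Finset.le_max' (Finset.univ.filter fun k => σ k = i) k' (by simpa using h')).eq_or_lt with h1 | h1
        · exact Or.inl h1
        · exact Or.inr ⟨h1, h'⟩
      · rintro (rfl | h')
        · exact hmem.2
        · exact h'.2
    have hk' := h k
    rw [remaining, hmem.2] at hk'
    rw [hsplit, Finset.sum_insert (by simp)]
    linarith

/-! ## The second stage for Bricks -/

lemma isIntegralAssignment_iff {ρ : ℝ} {b m : ℕ} {a : Fin b → ℝ} {s : Fin m → ℝ}
    {σ : Fin b → Fin m} :
    IsIntegralAssignment ρ a s σ ↔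
      IsGreedy (fun i => s i ≠ 0) (fun k => (⌈a k / ρ⌉ : ℝ)) s σ :=
  Iff.rfl

lemma sum_filter_lt_eq_sum_range {M : Type*} [AddCommMonoid M] {b : ℕ} (f : ℕ → M) (k : Fin b) :
    ∑ k' with k' < k, f k' = ∑ i ∈ Finset.range k, f i := by
  rw [← Nat.Iio_eq_range, ← Fin.map_valEmbedding_Iio, Finset.sum_map, ← Finset.filter_gt_eq_Iio]
  rfl

/-- IntegralAssignment respects the budgets if the costs of the bags are at most those which Bricks
pays for them. -/
lemma load_ceil_le {ρ : ℝ} {n m : ℕ} (hm : 0 < m) {a : Fin m → ℝ} {s : Fin m → ℕ}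
    (hs : ∑ i, s i = n) (ha : ∀ k : Fin m, ⌈a k / ρ⌉ ≤ ((bricksCoins n m k ⌈/⌉ m : ℕ) : ℤ))
    {σ : Fin m → Fin m} (hσ : IsIntegralAssignment ρ a (fun i => (s i : ℝ)) σ) (i : Fin m) :
    load (fun k => (⌈a k / ρ⌉ : ℝ)) σ i ≤ s i := by
  rw [isIntegralAssignment_iff] at hσ
  refine load_le_of_le_remaining (c := fun i => (s i : ℝ)) (fun i => Nat.cast_nonneg _)
    (fun k => ?_) i
  set t : Fin m → ℝ := fun k => (⌈a k / ρ⌉ : ℝ) with ht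
  have hcoins : ((bricksCoins n m k : ℕ) : ℝ) ≤
      ∑ i, ((s i : ℕ) : ℝ) - ∑ k' with k' < k, t k' := by
    have h1 := bricksCoins_add_sum (n := n) hm k
    have h2 : ∑ k' with k' < k, t k' ≤
        ((∑ i ∈ Finset.range k, bricksCoins n m i ⌈/⌉ m : ℕ) : ℝ) := by
      rw [← sum_filter_lt_eq_sum_range, Nat.cast_sum]
      refine Finset.sum_le_sum fun k' _ => ?_
      simp only [ht]
      exact_mod_cast ha k'
    rw [← Nat.cast_sum, hs]
    have h3 : ((bricksCoins n m k : ℕ) : ℝ) +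
        ((∑ i ∈ Finset.range k, bricksCoins n m i ⌈/⌉ m : ℕ) : ℝ) = n := by exact_mod_cast h1
    linarith
  have hle := hσ.sum_le (fun i hi => not_not.1 hi) k
    ((Nat.cast_nonneg _).trans hcoins)
  -- Budgets and costs are integers, so the lower bound on the maximum can be rounded up to the
  -- price of the bag.
  obtain ⟨M, hM⟩ : ∃ M : ℤ, (M : ℝ) = remaining t (fun i => (s i : ℝ)) σ k (σ k) := by
    refine ⟨s (σ k) - ∑ k' with k' < k ∧ σ k' = σ k, ⌈a k' / ρ⌉, ?_⟩
    simp [remaining, ht]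
  have hMm : ((bricksCoins n m k : ℕ) : ℝ) ≤ m * (M : ℝ) := by
    rw [hM]
    exact hcoins.trans hle
  have hMm' : ((bricksCoins n m k : ℕ) : ℤ) ≤ m * M := by exact_mod_cast hMm
  have hM0 : 0 ≤ M := by
    by_contra hneg
    push Not at hneg
    have : (m : ℤ) * M < 0 := mul_neg_of_pos_of_neg (by exact_mod_cast hm) hneg
    omega
  lift M to ℕ using hM0
  have hz : bricksCoins n m k ⌈/⌉ m ≤ M := by
    rw [ceilDiv_le_iff_le_smul hm, smul_eq_mul]
    exact_mod_cast hMm'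
  rw [← hM]
  have := (ha k).trans (Int.ofNat_le.2 hz)
  exact_mod_cast this

lemma ceil_load_div_le {n m : ℕ} {B : Fin n → Fin m} {k : Fin m}
    (hB : (Finset.univ.filter fun j => B j = k).card ≤ bricksSize (8 / 5) n m k) :
    ⌈load (fun _ => 1) B k / (8 / 5)⌉ ≤ ((bricksCoins n m k ⌈/⌉ m : ℕ) : ℤ) := by
  rw [Int.ceil_le, div_le_iff₀ (by norm_num)]
  have h1 : (bricksSize (8 / 5) n m k : ℝ) ≤ ((bricksCoins n m k ⌈/⌉ m : ℕ) : ℝ) * (8 / 5) :=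
    Nat.floor_le (by positivity)
  have h2 : load (fun _ => 1) B k = ((Finset.univ.filter fun j => B j = k).card : ℝ) := by
    simp [load]
  rw [h2, Int.cast_natCast]
  exact le_trans (by exact_mod_cast hB) h1

/-- A machine with `u i` jobs in the optimal schedule pays at most `u i` coins, each worth at most
`8/5` jobs, and `u i` jobs take time at most the optimum there. -/
lemma bricks_second_stage {n m : ℕ} (hn : 0 < n) (hm : 0 < m) {B : Fin n → Fin m}
    (hB : ∀ k, (Finset.univ.filter fun j => B j = k).card ≤ bricksSize (8 / 5) n m k)
    {p : Fin n → ℝ} (hp0 : ∀ j, 0 ≤ p j) (hp : IsBricks p) {s : Fin m → ℝ} (hs : IsSpeed s)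
    {τ : Fin n → Fin m} (hτ : IsOptimal p s τ) :
    (∃ σ, IsIntegralAssignment (8 / 5) (load (fun _ => 1) B) (load (fun _ => 1) τ) σ) ∧
      ∀ σ, IsIntegralAssignment (8 / 5) (load (fun _ => 1) B) (load (fun _ => 1) τ) σ →
        IsFeasible s σ ∧ makespan (load p B) s σ ≤ 8 / 5 * optMakespan p s := by
  set u : Fin m → ℕ := fun i => (Finset.univ.filter fun j => τ j = i).card with hu
  have hload : load (fun _ => 1) τ = fun i => (u i : ℝ) := by
    funext i
    simp [load, hu]
  have husum : ∑ i, u i = n := by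
    have := sum_load (fun _ => (1 : ℝ)) τ
    rw [hload] at this
    simp only [Finset.sum_const, Finset.card_univ, Fintype.card_fin, nsmul_eq_mul, mul_one] at this
    exact_mod_cast this
  constructor
  · rw [hload]
    simp only [isIntegralAssignment_iff]
    refine exists_isGreedy ⟨τ ⟨0, hn⟩, ?_⟩ _ _
    have : 0 < u (τ ⟨0, hn⟩) := Finset.card_pos.2 ⟨⟨0, hn⟩, by simp⟩
    exact_mod_cast this.ne'
  · intro σ hσ
    have hfeas : IsFeasible s σ := fun k h0 => (hσ k).1 (load_eq_zero hτ.1 h0)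
    refine ⟨hfeas, ?_⟩
    rw [hload] at hσ
    have hopt : 0 ≤ optMakespan p s := hτ.2 ▸ makespan_nonneg hp0 hs.1 τ
    refine makespan_le (by positivity) hs.1 fun i => ?_
    have hpc : p = fun _ => p ⟨0, hn⟩ := funext fun j => hp j _
    have h1 := load_ceil_le hm husum (fun k => ceil_load_div_le (hB k)) hσ i
    have h2 : load (load (fun _ => 1) B) σ i ≤ 8 / 5 * u i := by
      refine le_trans ?_ (mul_le_mul_of_nonneg_left h1 (by norm_num : (0 : ℝ) ≤ 8 / 5))
      unfold load
      rw [Finset.mul_sum]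
      refine Finset.sum_le_sum fun k _ => ?_
      have := Int.le_ceil (load (fun _ => 1) B k / (8 / 5))
      rw [div_le_iff₀ (by norm_num)] at this
      rw [mul_comm]
      exact this
    have h3 := load_le_makespan_mul hs.1 hτ.1 (w := p) i
    rw [hτ.2] at h3
    have h4 : load p τ i = p ⟨0, hn⟩ * u i := by
      rw [hpc, load_const, hload]
    have h5 : load (load p B) σ i = p ⟨0, hn⟩ * load (load (fun _ => 1) B) σ i := by
      unfold load
      rw [Finset.mul_sum]
      refine Finset.sum_congr rfl fun k _ => ?_
      rw [Finset.mul_sum]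
      exact Finset.sum_congr rfl fun j _ => by rw [mul_one]; exact hp _ _
    rw [h5]
    have h6 := mul_le_mul_of_nonneg_left h2 (hp0 ⟨0, hn⟩)
    rw [h4] at h3
    linarith

/-! ## Pebbles -/

lemma pebblesSkip_spec (ρ : ℝ) (m b : ℕ) (d : ℕ → ℝ) (x : ℝ) (k : ℕ) :
    k ≤ pebblesSkip ρ m b d x k ∧ (k ≤ b → pebblesSkip ρ m b d x k ≤ b) ∧
      (∀ l, k ≤ l → l < pebblesSkip ρ m b d x k →
        ρ - 1 / (m : ℝ) * ∑ ℓ ∈ Finset.range l, d ℓ < d l + x) ∧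
      (pebblesSkip ρ m b d x k < b →
        d (pebblesSkip ρ m b d x k) + x ≤
          ρ - 1 / (m : ℝ) * ∑ ℓ ∈ Finset.range (pebblesSkip ρ m b d x k), d ℓ) := by
  induction k using pebblesSkip.induct (ρ := ρ) (m := m) (b := b) (d := d) (x := x) with
  | case1 k h ih =>
    rw [pebblesSkip, if_pos h]
    obtain ⟨h1, h2, h3, h4⟩ := ih
    refine ⟨by omega, fun _ => h2 h.1, fun l hl hl' => ?_, h4⟩
    rcases hl.eq_or_lt with rfl | hlt
    · exact h.2
    · exact h3 l hlt hl'
  | case2 k h =>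
    rw [pebblesSkip, if_neg h]
    refine ⟨le_rfl, id, fun l hl hl' => absurd hl' (by omega), fun hk => ?_⟩
    by_contra hc
    exact h ⟨hk, not_le.1 hc⟩

/-- If every one of `m` bags is too full for another job of size `x`, then the bags contain more
than `m`. -/
lemma lt_sum_of_full {m : ℕ} (hm : 0 < m) {x : ℝ} (hx : x ≤ 1 / 60) (d : ℕ → ℝ)
    (h : ∀ l < m, 8 / 5 - 1 / (m : ℝ) * ∑ ℓ ∈ Finset.range l, d ℓ < d l + x) :
    (m : ℝ) < ∑ ℓ ∈ Finset.range m, d ℓ := by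
  have hm' : (0 : ℝ) < m := by exact_mod_cast hm
  have hm1 : (1 : ℝ) ≤ m := by exact_mod_cast hm
  set q : ℝ := 1 - 1 / m with hq
  have hq0 : 0 ≤ q := sub_nonneg.2 ((div_le_one hm').2 hm1)
  -- Fullness of bag `k` says that the partial sums `D` satisfy `D (k + 1) > q * D k + (8/5 - x)`;
  -- the left side here solves the recurrence with equality.
  have key : ∀ k ≤ m, m * (8 / 5 - x) * (1 - q ^ k) ≤ ∑ ℓ ∈ Finset.range k, d ℓ := by
    intro k hk
    induction k with
    | zero => simp
    | succ k ih =>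
      have h1 := ih (by omega)
      have h2 := h k (by omega)
      rw [Finset.sum_range_succ]
      have h3 := mul_le_mul_of_nonneg_left h1 hq0
      have h4 : q * ∑ ℓ ∈ Finset.range k, d ℓ =
          ∑ ℓ ∈ Finset.range k, d ℓ - 1 / (m : ℝ) * ∑ ℓ ∈ Finset.range k, d ℓ := by
        rw [hq]; ring
      have h5 : m * (8 / 5 - x) * (1 - q ^ (k + 1)) =
          q * (m * (8 / 5 - x) * (1 - q ^ k)) + (8 / 5 - x) := by
        have : (m : ℝ) * q = m - 1 := by rw [hq]; field_simp
        rw [pow_succ]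
        linear_combination (-(8 / 5 - x)) * this
      linarith
  refine lt_of_lt_of_le ?_ (key m le_rfl)
  have hexp : q ^ m ≤ Real.exp (-1) := by
    have := Real.one_sub_div_pow_le_exp_neg (n := m) (t := 1) hm1
    simpa [hq] using this
  have he := Real.exp_neg_one_lt_d9
  have h1 : (1 : ℝ) < (8 / 5 - x) * (1 - q ^ m) := by nlinarith
  nlinarith

/-- While Pebbles places jobs of size `x`, no bag before the current one can take a further job, no
bag after it has a job, and all bags satisfy the bound that governs the second stage. -/
lemma pebblesState_spec {n m : ℕ} (hm : 0 < m) {x : ℝ} (hx0 : 0 ≤ x) (hx : x ≤ 1 / 60)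
    (hnx : n * x ≤ m) (t : ℕ) (ht : t ≤ n) :
    let S := pebblesState (8 / 5) m m (fun _ : Fin n => x) t
    S.1 < m ∧ (∀ l, S.1 < l → S.2 l = 0) ∧
      (∀ l, S.1 < l → ∑ i ∈ Finset.range l, S.2 i = t * x) ∧
      (∀ l < S.1, 8 / 5 - 1 / (m : ℝ) * ∑ i ∈ Finset.range l, S.2 i < S.2 l + x) ∧
      (∀ l, S.2 l ≤ 8 / 5 - 1 / (m : ℝ) * ∑ i ∈ Finset.range l, S.2 i) ∧
      ∀ l, S.2 l = ∑ _j ∈ Finset.univ.filter (fun j : Fin n => (j : ℕ) < t ∧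
        (pebblesState (8 / 5) m m (fun _ : Fin n => x) (j + 1)).1 = l), x := by
  induction t with
  | zero =>
    simp only [pebblesState]
    refine ⟨hm, by simp, by simp, by simp, fun l => by norm_num, by simp⟩
  | succ t ih =>
    obtain ⟨hk, hzero, htotal, hfull, hfit, hload⟩ := ih (by omega)
    have htn : t < n := ht
    have hstep : pebblesState (8 / 5) m m (fun _ : Fin n => x) (t + 1) =
        pebblesStep (8 / 5) m m x (pebblesState (8 / 5) m m (fun _ : Fin n => x) t) := by
      rw [pebblesState, dif_pos htn]
    set k := (pebblesState (8 / 5) m m (fun _ : Fin n => x) t).1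
    set d := (pebblesState (8 / 5) m m (fun _ : Fin n => x) t).2
    obtain ⟨hle, hle', hskip, hplace⟩ := pebblesSkip_spec (8 / 5) m m d x k
    set k' := pebblesSkip (8 / 5) m m d x k with hk'def
    have htx : ((t + 1 : ℕ) : ℝ) * x ≤ m :=
      (mul_le_mul_of_nonneg_right (by exact_mod_cast ht) hx0).trans hnx
    have hfull' : ∀ l < k', 8 / 5 - 1 / (m : ℝ) * ∑ i ∈ Finset.range l, d i < d l + x := by
      intro l hl
      rcases Nat.lt_or_ge l k with h | h
      · exact hfull l h
      · exact hskip l h hl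
    -- Running out of bags would mean `m` full bags, holding more than the total of all jobs.
    have hk' : k' < m := by
      by_contra hge
      have := lt_sum_of_full hm hx d fun l hl => hfull' l (by omega)
      rw [htotal m hk] at this
      push_cast at htx
      linarith
    have hstep' : pebblesState (8 / 5) m m (fun _ : Fin n => x) (t + 1) =
        (k', Function.update d k' (d k' + x)) := by
      rw [hstep, pebblesStep]
      exact if_pos hk'
    have hsum_le : ∀ l ≤ k', ∑ i ∈ Finset.range l, Function.update d k' (d k' + x) i =
        ∑ i ∈ Finset.range l, d i := fun l hl =>
      Finset.sum_update_of_notMem (by simpa using hl) _ _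
    have hsum_gt : ∀ l, k' < l → ∑ i ∈ Finset.range l, Function.update d k' (d k' + x) i =
        ((t + 1 : ℕ) : ℝ) * x := by
      intro l hl
      have h1 := htotal l (by omega)
      have h2 := Finset.sum_update_of_mem (Finset.mem_range.2 hl) d (d k' + x)
      have h3 := Finset.add_sum_erase _ d (Finset.mem_range.2 hl)
      rw [h2, Finset.sdiff_singleton_eq_erase]
      push_cast
      linarith
    have hfirst : (pebblesState (8 / 5) m m (fun _ : Fin n => x) (t + 1)).1 = k' := by rw [hstep']
    rw [hstep']
    refine ⟨hk', fun l hl => ?_, hsum_gt, fun l hl => ?_, fun l => ?_, fun l => ?_⟩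
    · change Function.update d k' (d k' + x) l = 0
      rw [Function.update_of_ne (by omega)]
      exact hzero l (by omega)
    · change _ < Function.update d k' (d k' + x) l + x
      rw [Function.update_of_ne hl.ne, hsum_le l hl.le]
      exact hfull' l hl
    · change Function.update d k' (d k' + x) l ≤ _
      rcases lt_trichotomy l k' with h | rfl | h
      · rw [Function.update_of_ne h.ne, hsum_le l h.le]
        exact hfit l
      · rw [Function.update_self, hsum_le k' le_rfl]
        exact hplace hk'
      · rw [Function.update_of_ne h.ne', hsum_gt l h, hzero l (by omega)]
        have hm' : (0 : ℝ) < m := by exact_mod_cast hm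
        -- An empty bag meets its bound because the average load is at most `1 < 8/5`.
        have : 1 / (m : ℝ) * (((t + 1 : ℕ) : ℝ) * x) ≤ 1 := by
          rw [one_div_mul_eq_div]
          exact (div_le_one hm').2 htx
        linarith
    · change Function.update d k' (d k' + x) l = _
      rcases eq_or_ne l k' with rfl | h
      · rw [Function.update_self, hload k']
        have : (Finset.univ.filter fun j : Fin n => (j : ℕ) < t + 1 ∧
            (pebblesState (8 / 5) m m (fun _ : Fin n => x) (j + 1)).1 = k') =
            insert ⟨t, htn⟩ (Finset.univ.filter fun j : Fin n => (j : ℕ) < t ∧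
              (pebblesState (8 / 5) m m (fun _ : Fin n => x) (j + 1)).1 = k') := by
          ext j
          simp only [Finset.mem_insert, Finset.mem_filter, Finset.mem_univ, true_and, Fin.ext_iff]
          constructor
          · rintro ⟨h1, h2⟩
            rcases Nat.lt_succ_iff_lt_or_eq.1 h1 with h3 | h3
            · exact Or.inr ⟨h3, h2⟩
            · exact Or.inl h3
          · rintro (h1 | ⟨h1, h2⟩)
            · exact ⟨by omega, by rw [h1]; exact hfirst⟩
            · exact ⟨by omega, h2⟩
        rw [this, Finset.sum_insert (by simp), add_comm]
      · rw [Function.update_of_ne h, hload l]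
        refine Finset.sum_congr ?_ fun _ _ => rfl
        ext j
        simp only [Finset.mem_filter, Finset.mem_univ, true_and]
        constructor
        · rintro ⟨h1, h2⟩
          exact ⟨by omega, h2⟩
        · rintro ⟨h1, h2⟩
          refine ⟨?_, h2⟩
          rcases Nat.lt_succ_iff_lt_or_eq.1 h1 with h3 | h3
          · exact h3
          · rw [h3] at h2
            exact absurd (h2.symm.trans hfirst) h

/-- Pebbles places all jobs, and its bag sizes satisfy the bound that governs the second stage. -/
lemma exists_pebbles_eq_some {n m : ℕ} (hm : 0 < m) {x : ℝ} (hx0 : 0 ≤ x) (hx : x ≤ 1 / 60)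
    (hnx : n * x ≤ m) :
    ∃ A : Fin n → Fin m, (∀ j, pebbles (8 / 5) m m (fun _ : Fin n => x) j = some (A j)) ∧
      ∀ k, load (fun _ => x) A k + 1 / (m : ℝ) * ∑ l with l < k, load (fun _ => x) A l ≤ 8 / 5 := by
  have hlt : ∀ j : Fin n, (pebblesState (8 / 5) m m (fun _ : Fin n => x) (j + 1)).1 < m :=
    fun j => (pebblesState_spec hm hx0 hx hnx (j + 1) j.2).1
  refine ⟨fun j => ⟨_, hlt j⟩, fun j => ?_, fun k => ?_⟩
  · rw [pebbles, dif_pos (hlt j)]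
  · obtain ⟨-, -, -, -, hfit, hload⟩ := pebblesState_spec hm hx0 hx hnx n le_rfl
    set d := (pebblesState (8 / 5) m m (fun _ : Fin n => x) n).2
    have hd : ∀ l : Fin m, load (fun _ => x) (fun j : Fin n => (⟨_, hlt j⟩ : Fin m)) l = d l := by
      intro l
      rw [hload, load]
      refine Finset.sum_congr ?_ fun _ _ => rfl
      ext j
      simp [Fin.ext_iff]
    simp only [hd]
    rw [sum_filter_lt_eq_sum_range d k]
    have := hfit k
    linarith

/-! ### Scaling and robustness of the combined algorithm -/

lemma normalize_mul_sum_div {n m : ℕ} (hm : 0 < m) {p : Fin n → ℝ} (hp : ∀ j, 0 ≤ p j) (j : Fin n) :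
    p j = normalize m p j * ((∑ i, p i) / m) := by
  have hm' : (m : ℝ) ≠ 0 := by exact_mod_cast hm.ne'
  rcases eq_or_ne (∑ i, p i) 0 with h | h
  · rw [h, zero_div, mul_zero]
    exact (Finset.sum_eq_zero_iff_of_nonneg fun i _ => hp i).1 h j (Finset.mem_univ j)
  · unfold normalize
    field_simp

/-- Bags as small as those of Pebbles can be assigned greedily. -/
lemma exists_makespan_le_of_pebbles {n m : ℕ} {p : Fin n → ℝ} (hp : ∀ j, 0 ≤ p j)
    {A : Fin n → Fin m} {ρ : ℝ} (hρ : 1 ≤ ρ)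
    (hA : ∀ k, m * load p A k + ∑ l with l < k, load p A l ≤ ρ * ∑ j, p j)
    {s : Fin m → ℝ} (hs : IsSpeed s) :
    ∃ σ : Fin m → Fin m, IsFeasible s σ ∧ makespan (load p A) s σ ≤ ρ * optMakespan p s := by
  obtain ⟨τ, hτ⟩ := exists_isOptimal p hs
  set C := optMakespan p s with hC
  have hτC : makespan p s τ = C := hτ.2
  have hC0 : 0 ≤ C := hτC ▸ makespan_nonneg hp hs.1 τ
  -- The budget is what the machine may process within makespan `ρ * C`; the budgets total at least
  -- `ρ * ∑ j, p j`.
  obtain ⟨σ, hσ⟩ := exists_isGreedy (P := fun i => s i ≠ 0) hs.2 (load p A) fun i => ρ * C * s i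
  have htotal : ρ * ∑ j, p j ≤ ∑ i, ρ * C * s i := by
    rw [← sum_load p τ, Finset.mul_sum]
    refine Finset.sum_le_sum fun i _ => ?_
    rw [mul_assoc]
    refine mul_le_mul_of_nonneg_left ?_ (by linarith)
    rw [← hτC]
    exact load_le_makespan_mul hs.1 hτ.1 i
  refine ⟨σ, fun k => (hσ k).1, makespan_le (by positivity) hs.1 fun i => ?_⟩
  refine load_le_of_le_remaining (fun i => mul_nonneg (by positivity) (hs.1 i)) (fun k => ?_) i
  have hm : (0 : ℝ) < m := by exact_mod_cast Fin.pos k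
  have h1 := hA k
  have h2 : 0 ≤ m * load p A k := mul_nonneg hm.le (load_nonneg hp A k)
  have h3 := hσ.sum_le (fun i hi => by rw [not_not.1 hi, mul_zero]) k (by linarith)
  exact le_of_mul_le_mul_left (by linarith) hm

lemma pebbles_bricks {n m : ℕ} (hm : 0 < m) (hn : 60 * m ≤ n) {p : Fin n → ℝ}
    (hp0 : ∀ j, 0 ≤ p j) (hp : IsBricks p) :
    ∃ A : Fin n → Fin m, (∀ j, pebbles (8 / 5) m m (normalize m p) j = some (A j)) ∧
      ∀ k, m * load p A k + ∑ l with l < k, load p A l ≤ 8 / 5 * ∑ j, p j := by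
  have hm' : (0 : ℝ) < m := by exact_mod_cast hm
  have hn0 : 0 < n := by omega
  have hP : ∑ j, p j = n * p ⟨0, hn0⟩ := by
    rw [Finset.sum_congr rfl fun j _ => hp j ⟨0, hn0⟩]
    simp
  set x := normalize m p ⟨0, hn0⟩ with hx
  have hnorm : normalize m p = fun _ => x := by
    funext j
    rw [hx, normalize, normalize, hp j ⟨0, hn0⟩]
  have hxn : n * x ≤ m := by
    rw [hx, normalize, hP]
    -- If all jobs have size zero, scaling gives `x = 0`, so only the inequality holds in general.
    rcases (hp0 ⟨0, hn0⟩).eq_or_lt with h | h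
    · simp [← h]
    · have : (0 : ℝ) < n := by exact_mod_cast hn0
      refine le_of_eq ?_
      field_simp
  have hx0 : 0 ≤ x := div_nonneg (mul_nonneg (hp0 _) hm'.le) (Finset.sum_nonneg fun j _ => hp0 j)
  have hx60 : x ≤ 1 / 60 := by
    have : (60 : ℝ) * m ≤ n := by exact_mod_cast hn
    have := mul_le_mul_of_nonneg_right this hx0
    have h : (60 * x) * m ≤ 1 * m := by linarith
    have := le_of_mul_le_mul_right h hm'
    linarith
  obtain ⟨A, hA, hload⟩ := exists_pebbles_eq_some hm hx0 hx60 hxn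
  refine ⟨A, hnorm ▸ hA, fun k => ?_⟩
  have hl : ∀ k, load p A k = load (fun _ => x) A k * ((∑ i, p i) / m) := by
    intro k
    unfold load
    rw [Finset.sum_mul]
    refine Finset.sum_congr rfl fun j _ => ?_
    rw [← congrFun hnorm j]
    exact normalize_mul_sum_div hm hp0 j
  have hP0 : 0 ≤ ∑ i, p i := Finset.sum_nonneg fun j _ => hp0 j
  have := mul_le_mul_of_nonneg_right (hload k) hP0
  simp only [hl]
  rw [← Finset.sum_mul]
  refine le_trans (le_of_eq ?_) this
  field_simp

/-- Pebbles for at least `60` jobs per machine, and Bricks otherwise. -/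
noncomputable def pebblesOrBricks : FirstStageAlgorithm := fun n m b _ p j =>
  -- The default bag `0` is never used for bricks with `b = m > 0`, since all jobs are then placed.
  if 60 * m ≤ n then (pebbles (8 / 5) m b (normalize m p) j).getD 0
  else (bricks (8 / 5) n m b j).getD 0

lemma isRobustOn_pebblesOrBricks :
    IsRobustOn pebblesOrBricks (fun _ m b p => b = m ∧ IsBricks p) (8 / 5) := by
  rintro n m b _ p hn hm hp0 ⟨rfl, hp⟩ s hs
  by_cases h : 60 * b ≤ n
  · obtain ⟨A, hA, hload⟩ := pebbles_bricks hm h hp0 hp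
    have : pebblesOrBricks n b b p = A := by
      funext j
      simp [pebblesOrBricks, h, hA j]
    rw [this]
    exact exists_makespan_le_of_pebbles hp0 (by norm_num) hload hs
  · obtain ⟨B, hB, hcard⟩ := exists_bricks_eq_some (n := n) hm (by omega)
    have : pebblesOrBricks n b b p = B := by
      funext j
      simp [pebblesOrBricks, h, hB j]
    rw [this]
    obtain ⟨τ, hτ⟩ := exists_isOptimal p hs
    obtain ⟨⟨σ, hσ⟩, h2⟩ := bricks_second_stage hn hm hcard hp0 hp hs hτ
    exact ⟨σ, h2 σ hσ⟩

end SpeedRobust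

theorem mainTheorem1 :
    (∃ A : SpeedRobust.FirstStageAlgorithm,
      -- the algorithm is 1.6-robust for bricks and as many bags as machines
      SpeedRobust.IsRobustOn A (fun _ m b p => b = m ∧ SpeedRobust.IsBricks p) (8 / 5) ∧
      -- for `n / m ≥ 60` it is Pebbles, run on the scaled instance
      (∀ (n m : ℕ) [NeZero m] (p : Fin n → ℝ), (∀ j, 0 ≤ p j) → SpeedRobust.IsBricks p →
        60 * m ≤ n → ∀ j,
          SpeedRobust.pebbles (8 / 5) m m (SpeedRobust.normalize m p) j = some (A n m m p j)) ∧
      -- for `n / m < 60` it is Bricks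
      (∀ (n m : ℕ) [NeZero m] (p : Fin n → ℝ), (∀ j, 0 ≤ p j) → SpeedRobust.IsBricks p →
        n < 60 * m → ∀ j,
          SpeedRobust.bricks (8 / 5) n m m j = some (A n m m p j))) ∧
    -- for `n / m ≤ 60` Bricks packs all jobs, and IntegralAssignment, run on the speeds that an
    -- optimal schedule uses (the numbers of jobs on the machines), solves the second stage
    (∀ n m : ℕ, 0 < n → 0 < m → n ≤ 60 * m →
      ∃ B : Fin n → Fin m, (∀ j, SpeedRobust.bricks (8 / 5) n m m j = some (B j)) ∧
        ∀ (p : Fin n → ℝ), (∀ j, 0 ≤ p j) → SpeedRobust.IsBricks p →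
        ∀ (s : Fin m → ℝ), SpeedRobust.IsSpeed s →
        ∀ τ : Fin n → Fin m, SpeedRobust.IsOptimal p s τ →
          (∃ σ : Fin m → Fin m, SpeedRobust.IsIntegralAssignment (8 / 5)
            (SpeedRobust.load (fun _ => 1) B) (SpeedRobust.load (fun _ => 1) τ) σ) ∧
          ∀ σ : Fin m → Fin m, SpeedRobust.IsIntegralAssignment (8 / 5)
            (SpeedRobust.load (fun _ => 1) B) (SpeedRobust.load (fun _ => 1) τ) σ →
            SpeedRobust.IsFeasible s σ ∧
            SpeedRobust.makespan (SpeedRobust.load p B) s σ ≤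
              8 / 5 * SpeedRobust.optMakespan p s) := by
  refine ⟨⟨SpeedRobust.pebblesOrBricks, SpeedRobust.isRobustOn_pebblesOrBricks, ?_, ?_⟩, ?_⟩
  · intro n m _ p hp0 hp hn j
    obtain ⟨A, hA, -⟩ := SpeedRobust.pebbles_bricks (Nat.pos_of_neZero m) hn hp0 hp
    simp [SpeedRobust.pebblesOrBricks, hn, hA j]
  · intro n m _ p _ _ hn j
    obtain ⟨B, hB, -⟩ := SpeedRobust.exists_bricks_eq_some (Nat.pos_of_neZero m) hn.le
    simp [SpeedRobust.pebblesOrBricks, not_le.2 hn, hB j]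
  · intro n m hn hm hnm
    obtain ⟨B, hB, hcard⟩ := SpeedRobust.exists_bricks_eq_some hm hnm
    exact ⟨B, hB, fun p hp0 hp s hs τ hτ =>
      SpeedRobust.bricks_second_stage hn hm hcard hp0 hp hs hτ⟩
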